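/- Let $\mathcal F$ be the set of maps $f:(0,\infty)\to(0,\infty)$ of the form $f(x)=\frac{ax+b}{cx+d}$ with $a,b,c,d\ge 0$ and $ad-bc\ne 0$, a semigroup under composition, with the topology of pointwise convergence on $(0,\infty)$. For two elements $f,g$ of a semigroup with identity, let $\langle f,g\rangle$ be the set of all finite products of copies of $f$ and $g$, the empty product (the identity) included. (1) For all $f,g\in\mathcal F$, the semigroup $\langle f,g\rangle$ is not dense in $\mathcal F$. (2) Let $I\subsetneq\mathbb R$ be a proper subinterval with more than one point (open, closed or half-open, bounded or unbounded). Let $\mathcal F_I$ be the semigroup, under composition, of all maps $f:I\to I$ of the form $f(x)=\frac{ax+b}{cx+d}$ with $a,b,c,d\in\mathbb R$, $ad-bc\neq0$ and $cx+d\ne0$ for every $x\in I$, with the topology of pointwise convergence on $I$. Then for all $f,g\in\mathcal F_I$, the semigroup $\langle f,g\rangle$ is not dense in $\mathcal F_I$. (3) Let $M$ be the multiplicative semigroup of all real $2\times2$ matrices with nonnegative entries, with its usual (entrywise) topology. Then for all $A,B\in M$, the semigroup $\langle A,B\rangle$ is not dense in $M$. -/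

import Mathlib

/-- The linear fractional maps `x ↦ (a x + b) / (c x + d)` with `a, b, c, d ≥ 0` and
`a d - b c ≠ 0`, as self-maps of `(0, ∞)`; multiplication is composition of maps. Here
`c x + d > 0` for all `x > 0`, because `c` and `d` cannot both vanish. -/
def nonnegLFT : Submonoid (Function.End (Set.Ioi (0 : ℝ))) where
  carrier := {f | ∃ a b c d : ℝ, 0 ≤ a ∧ 0 ≤ b ∧ 0 ≤ c ∧ 0 ≤ d ∧ a * d - b * c ≠ 0 ∧
    ∀ x : Set.Ioi (0 : ℝ), ((f x : Set.Ioi (0 : ℝ)) : ℝ) = (a * x + b) / (c * x + d)}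
  one_mem' := ⟨1, 0, 0, 1, by norm_num, le_rfl, le_rfl, by norm_num, by norm_num,
    fun x => by simp [Function.End.one_def]⟩
  mul_mem' := by
    rintro f g ⟨a, b, c, d, ha, hb, hc, hd, hdet, hf⟩ ⟨p, q, r, s, hp, hq, hr, hs, hdet', hg⟩
    refine ⟨a * p + b * r, a * q + b * s, c * p + d * r, c * q + d * s, by positivity,
      by positivity, by positivity, by positivity, ?_, ?_⟩
    · have : (a * p + b * r) * (c * q + d * s) - (a * q + b * s) * (c * p + d * r)
          = (a * d - b * c) * (p * s - q * r) := by ring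
      rw [this]
      exact mul_ne_zero hdet hdet'
    · intro x
      have hx : (0 : ℝ) < x := x.2
      have hrs : r * (x : ℝ) + s ≠ 0 := by
        intro h
        have h1 : 0 ≤ r * (x : ℝ) := by positivity
        have h2 : r * (x : ℝ) = 0 := by linarith
        have h3 : r = 0 := by
          rcases mul_eq_zero.mp h2 with h4 | h4
          · exact h4
          · exact absurd h4 hx.ne'
        have h5 : s = 0 := by linarith
        exact hdet' (by rw [h3, h5]; ring)
      have key : (((f * g) x : Set.Ioi (0 : ℝ)) : ℝ) =
          (a * ((g x : Set.Ioi (0 : ℝ)) : ℝ) + b) / (c * ((g x : Set.Ioi (0 : ℝ)) : ℝ) + d) :=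
        hf (g x)
      have hgx : ((g x : Set.Ioi (0 : ℝ)) : ℝ) * (r * (x : ℝ) + s) = p * x + q := by
        rw [hg x, div_mul_cancel₀ _ hrs]
      rw [key, ← mul_div_mul_right _ _ hrs]
      congr 1
      · linear_combination a * hgx
      · linear_combination c * hgx

/-- The real linear fractional self-maps of a set `I ⊆ ℝ`: the maps `f : I → I` of the form
`x ↦ (a x + b) / (c x + d)` with `a, b, c, d` real, `a d - b c ≠ 0` and no pole in `I`;
multiplication is composition of maps. -/
def realLFT (I : Set ℝ) : Submonoid (Function.End I) where
  carrier := {f | ∃ a b c d : ℝ, a * d - b * c ≠ 0 ∧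
    ∀ x : I, c * (x : ℝ) + d ≠ 0 ∧ ((f x : I) : ℝ) = (a * x + b) / (c * x + d)}
  one_mem' := ⟨1, 0, 0, 1, by norm_num, fun x => by simp [Function.End.one_def]⟩
  mul_mem' := by
    rintro f g ⟨a, b, c, d, hdet, hf⟩ ⟨p, q, r, s, hdet', hg⟩
    refine ⟨a * p + b * r, a * q + b * s, c * p + d * r, c * q + d * s, ?_, ?_⟩
    · have : (a * p + b * r) * (c * q + d * s) - (a * q + b * s) * (c * p + d * r)
          = (a * d - b * c) * (p * s - q * r) := by ring
      rw [this]
      exact mul_ne_zero hdet hdet'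
    · intro x
      obtain ⟨hrs, hgx⟩ := hg x
      obtain ⟨hcd, hfx⟩ := hf (g x)
      have key : (((f * g) x : I) : ℝ) =
          (a * ((g x : I) : ℝ) + b) / (c * ((g x : I) : ℝ) + d) := hfx
      have hgx' : ((g x : I) : ℝ) * (r * (x : ℝ) + s) = p * x + q := by
        rw [hgx, div_mul_cancel₀ _ hrs]
      have e1 : (c * ((g x : I) : ℝ) + d) * (r * (x : ℝ) + s)
          = (c * p + d * r) * x + (c * q + d * s) := by
        linear_combination c * hgx'
      have e2 : (a * ((g x : I) : ℝ) + b) * (r * (x : ℝ) + s)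
          = (a * p + b * r) * x + (a * q + b * s) := by
        linear_combination a * hgx'
      refine ⟨?_, ?_⟩
      · rw [← e1]
        exact mul_ne_zero hcd hrs
      · rw [key, ← e1, ← e2, mul_div_mul_right _ _ hrs]

/-- The topology of pointwise convergence on `nonnegLFT`. -/
instance nonnegLFT.topology : TopologicalSpace nonnegLFT :=
  TopologicalSpace.induced
    (fun (f : nonnegLFT) (x : Set.Ioi (0 : ℝ)) => ((f.1 x : Set.Ioi (0 : ℝ)) : ℝ)) inferInstance

/-- The topology of pointwise convergence on `realLFT I`. -/
instance realLFT.topology (I : Set ℝ) : TopologicalSpace (realLFT I) :=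
  TopologicalSpace.induced (fun (f : realLFT I) (x : I) => ((f.1 x : I) : ℝ)) inferInstance

/-- The multiplicative semigroup of real `2 × 2` matrices with nonnegative entries; it carries
the subspace topology of the entrywise topology on matrices. -/
def nonnegMat : Submonoid (Matrix (Fin 2) (Fin 2) ℝ) where
  carrier := {A | ∀ i j, 0 ≤ A i j}
  one_mem' := fun i j => by
    rw [Matrix.one_apply]
    split_ifs <;> norm_num
  mul_mem' := fun {A B} hA hB i j => by
    rw [Matrix.mul_apply]
    exact Finset.sum_nonneg fun k _ => mul_nonneg (hA i k) (hB k j)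

/-! All three statements reduce to one about two nonnegative matrices A, B: their words avoid a
scale-invariant neighbourhood of some test matrix (`misses_closure_pair`). Compare the two terms of
the determinant, p = A₀₀A₁₁ and q = A₀₁A₁₀. If p, q are both zero or both positive, A is
`Comparable`, a property that survives multiplication by nonnegative matrices on either side. Hence
noncomparable words are powers of B, whose off-diagonal entries are proportional to those of B, so
they cannot approach both the upper and the lower unipotent matrix. Otherwise each generator has
exactly one positive term. If it is p for both, all words have determinant ≥ 0. If it is q for at
least one, each generator dominates a monomial matrix of equal determinant; so does every word, and
the monomial maps are ρᵏx and αρᵏ/x. The gap above 1 in the powers of ρ excludes some diag(t, 1)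
(`misses_of_dominatesMonomial`). For maps, an interval is charted projectively onto (0, ∞), up to
endpoints. Self-maps then have nonnegative matrices, recovered continuously, up to scale, from the
values at three points (`not_dense_of_represents`). -/

/-- The test matrices whose projective neighbourhoods detect non-density. -/
def IsProbe (T : Matrix (Fin 2) (Fin 2) ℝ) : Prop :=
  T = !![1, 2; 1, 1] ∨ T = !![1, 1; 0, 1] ∨ T = !![1, 0; 1, 1] ∨ ∃ t : ℝ, 1 < t ∧ T = !![t, 0; 0, 1]

/-! ### Comparable determinant terms -/

/-- The two terms of the determinant of `W` are comparable up to the factor `κ`. -/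
def Comparable (κ : ℝ) (W : Matrix (Fin 2) (Fin 2) ℝ) : Prop :=
  κ * (W 0 0 * W 1 1) ≤ W 0 1 * W 1 0 ∧ κ * (W 0 1 * W 1 0) ≤ W 0 0 * W 1 1

lemma nonneg_of_mem_closure {A B W : Matrix (Fin 2) (Fin 2) ℝ} (hA : ∀ i j, 0 ≤ A i j)
    (hB : ∀ i j, 0 ≤ B i j) (hW : W ∈ Submonoid.closure {A, B}) : ∀ i j, 0 ≤ W i j := by
  have : Submonoid.closure {A, B} ≤ nonnegMat := by
    rw [Submonoid.closure_le]
    rintro X (rfl | rfl)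
    · exact hA
    · exact hB
  exact this hW

/-- Write p, q for the diagonal and antidiagonal products. Those of UV share two nonnegative terms,
where κ ≤ 1 suffices; the rest are p(U)p(V) + q(U)q(V) and p(U)q(V) + q(U)p(V), exchanged by
swapping p(U) and q(U). -/
lemma Comparable.mul_right {κ : ℝ} {U V : Matrix (Fin 2) (Fin 2) ℝ} (h : Comparable κ U)
    (hκ : κ ≤ 1) (hU : ∀ i j, 0 ≤ U i j) (hV : ∀ i j, 0 ≤ V i j) : Comparable κ (U * V) := by
  obtain ⟨h1, h2⟩ := h
  have a1 := mul_le_mul_of_nonneg_right h1 (mul_nonneg (hV 0 0) (hV 1 1))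
  have a2 := mul_le_mul_of_nonneg_right h1 (mul_nonneg (hV 0 1) (hV 1 0))
  have a3 := mul_le_mul_of_nonneg_right h2 (mul_nonneg (hV 0 0) (hV 1 1))
  have a4 := mul_le_mul_of_nonneg_right h2 (mul_nonneg (hV 0 1) (hV 1 0))
  have b1 := mul_le_mul_of_nonneg_right hκ
    (mul_nonneg (mul_nonneg (hU 0 0) (hU 1 0)) (mul_nonneg (hV 0 0) (hV 0 1)))
  have b2 := mul_le_mul_of_nonneg_right hκ
    (mul_nonneg (mul_nonneg (hU 0 1) (hU 1 1)) (mul_nonneg (hV 1 0) (hV 1 1)))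
  simp only [Comparable, Matrix.mul_apply, Fin.sum_univ_two]
  constructor <;> linarith

lemma Comparable.mul_left {κ : ℝ} {U V : Matrix (Fin 2) (Fin 2) ℝ} (h : Comparable κ V)
    (hκ : κ ≤ 1) (hU : ∀ i j, 0 ≤ U i j) (hV : ∀ i j, 0 ≤ V i j) : Comparable κ (U * V) := by
  obtain ⟨h1, h2⟩ := h
  have a1 := mul_le_mul_of_nonneg_right h1 (mul_nonneg (hU 0 0) (hU 1 1))
  have a2 := mul_le_mul_of_nonneg_right h1 (mul_nonneg (hU 0 1) (hU 1 0))
  have a3 := mul_le_mul_of_nonneg_right h2 (mul_nonneg (hU 0 0) (hU 1 1))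
  have a4 := mul_le_mul_of_nonneg_right h2 (mul_nonneg (hU 0 1) (hU 1 0))
  have b1 := mul_le_mul_of_nonneg_right hκ
    (mul_nonneg (mul_nonneg (hU 0 0) (hU 1 0)) (mul_nonneg (hV 0 0) (hV 0 1)))
  have b2 := mul_le_mul_of_nonneg_right hκ
    (mul_nonneg (mul_nonneg (hU 0 1) (hU 1 1)) (mul_nonneg (hV 1 0) (hV 1 1)))
  simp only [Comparable, Matrix.mul_apply, Fin.sum_univ_two]
  constructor <;> linarith

lemma comparable_or_mem_powers {A B W : Matrix (Fin 2) (Fin 2) ℝ} {κ : ℝ} (hκ : κ ≤ 1)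
    (hA : ∀ i j, 0 ≤ A i j) (hB : ∀ i j, 0 ≤ B i j) (hAκ : Comparable κ A)
    (hW : W ∈ Submonoid.closure {A, B}) : Comparable κ W ∨ W ∈ Submonoid.powers B := by
  induction hW using Submonoid.closure_induction with
  | mem X hX =>
    rcases hX with rfl | rfl
    · exact Or.inl hAκ
    · exact Or.inr (Submonoid.mem_powers _)
  | one => exact Or.inr (one_mem _)
  | mul U V hU hV ihU ihV =>
    have nU := nonneg_of_mem_closure hA hB hU
    have nV := nonneg_of_mem_closure hA hB hV
    rcases ihU with h | h
    · exact Or.inl (h.mul_right hκ nU nV)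
    rcases ihV with h' | h'
    · exact Or.inl (h'.mul_left hκ nU nV)
    · exact Or.inr (mul_mem h h')

/-- A power of a nonnegative `B` is a combination of `B` and `1` with nonnegative weight on `B`. -/
lemma exists_eq_smul_add_of_mem_powers {B W : Matrix (Fin 2) (Fin 2) ℝ} (hB : ∀ i j, 0 ≤ B i j)
    (hW : W ∈ Submonoid.powers B) : ∃ x y : ℝ, 0 ≤ x ∧ W = x • B + y • 1 := by
  obtain ⟨n, rfl⟩ := (Submonoid.mem_powers_iff W B).mp hW
  clear hW
  induction n with
  | zero => exact ⟨0, 1, le_rfl, by simp⟩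
  | succ n ih =>
    obtain ⟨x, y, hx, h⟩ := ih
    have hn : 0 ≤ (B ^ n) 0 0 :=
      (pow_mem (show B ∈ nonnegMat from hB) n : B ^ n ∈ nonnegMat) 0 0
    -- Cayley–Hamilton: B² = (tr B)B − (det B)1. The new weight is (Bⁿ)₀₀ + x B₁₁, hence nonnegative
    -- although y may be negative.
    refine ⟨x * (B 0 0 + B 1 1) + y, -x * B.det, ?_, ?_⟩
    · rw [h] at hn
      simp at hn
      have := mul_nonneg hx (hB 1 1)
      linarith
    · rw [pow_succ, h]
      ext i j
      fin_cases i <;> fin_cases j <;>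
        simp [Matrix.mul_apply, Fin.sum_univ_two, Matrix.det_fin_two] <;> ring

/-! ### Monomial parts and the gap in the powers of ρ -/

/-- `W` dominates entrywise a monomial matrix with the same determinant whose associated map is
`x ↦ ρ ^ k * x` or `x ↦ α * ρ ^ k / x`. -/
def DominatesMonomial (ρ α : ℝ) (W : Matrix (Fin 2) (Fin 2) ℝ) : Prop :=
  ∃ (k : ℤ) (b : ℝ), 0 < b ∧
    ((ρ ^ k * b ≤ W 0 0 ∧ b ≤ W 1 1 ∧ W.det = ρ ^ k * b * b) ∨
     (α * ρ ^ k * b ≤ W 0 1 ∧ b ≤ W 1 0 ∧ W.det = -(α * ρ ^ k * b * b)))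

/-- The maps ρᵏx and αρᵏ/x are closed under composition, determinants multiply, and the extra terms
in a product of nonnegative matrices only increase its entries. An inversion on the left subtracts
exponents. -/
lemma DominatesMonomial.mul {ρ α : ℝ} (hρ : 0 < ρ) (hα : 0 < α)
    {U V : Matrix (Fin 2) (Fin 2) ℝ} (hU : ∀ i j, 0 ≤ U i j) (hV : ∀ i j, 0 ≤ V i j)
    (h : DominatesMonomial ρ α U) (h' : DominatesMonomial ρ α V) :
    DominatesMonomial ρ α (U * V) := by
  obtain ⟨k, b, hb, h⟩ := h
  obtain ⟨l, c, hc, h'⟩ := h'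
  have hk : 0 < ρ ^ k := zpow_pos hρ k
  have hl : 0 < ρ ^ l := zpow_pos hρ l
  have key : ∀ {x y z w : ℝ}, 0 ≤ x → 0 ≤ y → x ≤ z → y ≤ w → x * y ≤ z * w :=
    fun hx hy hxz hyw => mul_le_mul hxz hyw hy (hx.trans hxz)
  have m : ∀ i j i' j', 0 ≤ U i j * V i' j' := fun i j i' j' => mul_nonneg (hU i j) (hV i' j')
  have e : ρ ^ l = ρ ^ (l - k) * ρ ^ k := by rw [← zpow_add₀ hρ.ne']; congr 1; ring
  have e' : ρ ^ k = ρ ^ (k - l) * ρ ^ l := by rw [← zpow_add₀ hρ.ne']; congr 1; ring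
  have p1 : 0 < ρ ^ (l - k) := zpow_pos hρ _
  have p2 : 0 < ρ ^ (k - l) := zpow_pos hρ _
  rcases h with ⟨h1, h2, h3⟩ | ⟨h1, h2, h3⟩ <;> rcases h' with ⟨h1', h2', h3'⟩ | ⟨h1', h2', h3'⟩
  · refine ⟨k + l, b * c, by positivity, Or.inl ⟨?_, ?_, ?_⟩⟩
    · rw [Matrix.mul_apply, Fin.sum_univ_two, zpow_add₀ hρ.ne']
      have := key (by positivity) (by positivity) h1 h1'
      linarith [m 0 1 1 0]
    · rw [Matrix.mul_apply, Fin.sum_univ_two]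
      have := key (by positivity) (by positivity) h2 h2'
      linarith [m 1 0 0 1]
    · rw [Matrix.det_mul, h3, h3', zpow_add₀ hρ.ne']; ring
  · refine ⟨k + l, b * c, by positivity, Or.inr ⟨?_, ?_, ?_⟩⟩
    · rw [Matrix.mul_apply, Fin.sum_univ_two, zpow_add₀ hρ.ne']
      have := key (by positivity) (by positivity) h1 h1'
      linarith [m 0 1 1 1]
    · rw [Matrix.mul_apply, Fin.sum_univ_two]
      have := key (by positivity) (by positivity) h2 h2'
      linarith [m 1 0 0 0]
    · rw [Matrix.det_mul, h3, h3', zpow_add₀ hρ.ne']; ring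
  · refine ⟨k - l, ρ ^ l * b * c, by positivity, Or.inr ⟨?_, ?_, ?_⟩⟩
    · rw [Matrix.mul_apply, Fin.sum_univ_two]
      have := key (by positivity) (by positivity) h1 h2'
      rw [e'] at this
      linarith [m 0 0 0 1]
    · rw [Matrix.mul_apply, Fin.sum_univ_two]
      have := key (by positivity) (by positivity) h2 h1'
      linarith [m 1 1 1 0]
    · rw [Matrix.det_mul, h3, h3', e']; ring
  · refine ⟨k - l, α * ρ ^ l * b * c, by positivity, Or.inl ⟨?_, ?_, ?_⟩⟩
    · rw [Matrix.mul_apply, Fin.sum_univ_two]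
      have := key (by positivity) (by positivity) h1 h2'
      rw [e'] at this
      linarith [m 0 0 0 0]
    · rw [Matrix.mul_apply, Fin.sum_univ_two]
      have := key (by positivity) (by positivity) h2 h1'
      linarith [m 1 1 1 1]
    · rw [Matrix.det_mul, h3, h3', e']; ring

lemma dominatesMonomial_of_mem_closure {ρ α : ℝ} (hρ : 0 < ρ) (hα : 0 < α)
    {A B W : Matrix (Fin 2) (Fin 2) ℝ} (hA : ∀ i j, 0 ≤ A i j) (hB : ∀ i j, 0 ≤ B i j)
    (hA' : DominatesMonomial ρ α A) (hB' : DominatesMonomial ρ α B)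
    (hW : W ∈ Submonoid.closure {A, B}) : DominatesMonomial ρ α W := by
  induction hW using Submonoid.closure_induction with
  | mem X hX =>
    rcases hX with rfl | rfl
    · exact hA'
    · exact hB'
  | one => exact ⟨0, 1, one_pos, Or.inl (by simp)⟩
  | mul U V hU hV ihU ihV =>
    exact ihU.mul hρ hα (nonneg_of_mem_closure hA hB hU) (nonneg_of_mem_closure hA hB hV) ihV

lemma exists_gap_zpow {ρ : ℝ} (hρ : 0 < ρ) : ∃ u : ℝ, 1 < u ∧ ∀ k : ℤ, ρ ^ k ≤ 1 ∨ u ≤ ρ ^ k := by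
  have aux : ∀ {σ : ℝ}, 1 < σ → ∀ k : ℤ, σ ^ k ≤ 1 ∨ σ ≤ σ ^ k := by
    intro σ hσ k
    rcases le_or_gt k 0 with hk | hk
    · exact Or.inl (zpow_le_one_of_nonpos₀ hσ.le hk)
    · right
      calc σ = σ ^ (1 : ℤ) := (zpow_one σ).symm
        _ ≤ σ ^ k := zpow_le_zpow_right₀ hσ.le hk
  rcases lt_trichotomy ρ 1 with h | rfl | h
  · refine ⟨ρ⁻¹, (one_lt_inv₀ hρ).mpr h, fun k => ?_⟩
    have := aux ((one_lt_inv₀ hρ).mpr h) (-k)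
    rwa [inv_zpow, zpow_neg, inv_inv] at this
  · exact ⟨2, one_lt_two, fun k => Or.inl (by simp)⟩
  · exact ⟨ρ, h, aux h⟩

/-- The diagonal entries of a matrix dominating a monomial one obey the gap in the powers of `ρ`. -/
lemma DominatesMonomial.not_probe {ρ α u : ℝ} (hρ : 0 < ρ) (hα : 0 < α)
    (hu : ∀ k : ℤ, ρ ^ k ≤ 1 ∨ u ≤ ρ ^ k) {W : Matrix (Fin 2) (Fin 2) ℝ}
    (h : DominatesMonomial ρ α W) :
    ¬ (W 1 1 ^ 2 < W.det ∧ W 0 0 ^ 2 < u * W.det) := by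
  rintro ⟨h1, h2⟩
  obtain ⟨k, b, hb, ⟨ha, hb', hd⟩ | ⟨-, -, hd⟩⟩ := h
  · have hk : 0 < ρ ^ k := zpow_pos hρ k
    rw [hd] at h1 h2
    -- The first inequality gives b² ≤ W₁₁² < ρᵏb², so ρᵏ > 1 and thus ρᵏ ≥ u. Then W₀₀² ≥ ρ²ᵏb² =
    -- ρᵏ det W ≥ u det W, against the second.
    rcases hu k with h | h
    · have := pow_le_pow_left₀ hb.le hb' 2
      have := mul_le_mul_of_nonneg_right h (mul_pos hb hb).le
      nlinarith
    · have h3 := pow_le_pow_left₀ (by positivity) ha 2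
      have h4 := mul_le_mul_of_nonneg_right h (by positivity : 0 ≤ ρ ^ k * b * b)
      nlinarith
  · have : 0 < α * ρ ^ k * b * b := by have := zpow_pos hρ k; positivity
    nlinarith [sq_nonneg (W 1 1)]

lemma isOpen_setOf_probe {f g : Matrix (Fin 2) (Fin 2) ℝ → ℝ} (hf : Continuous f)
    (hg : Continuous g) : IsOpen {W | 0 < f W ∧ 0 < g W} :=
  (isOpen_lt continuous_const hf).inter (isOpen_lt continuous_const hg)

/-! ### Test matrices missed by two nonnegative matrices -/

/-- `S` misses an open, scale-invariant neighbourhood of some probe. -/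
def Misses (S : Set (Matrix (Fin 2) (Fin 2) ℝ)) : Prop :=
  ∃ T U, IsProbe T ∧ IsOpen U ∧ (∀ W ∈ U, ∀ c : ℝ, c ≠ 0 → c • W ∈ U) ∧ T ∈ U ∧ ∀ W ∈ S, W ∉ U

/-- Homogeneity of even degree makes the neighbourhood invariant under negative scalars too; the
matrix of a map is only known up to such a scalar. -/
lemma misses_of_forms {S : Set (Matrix (Fin 2) (Fin 2) ℝ)} {T : Matrix (Fin 2) (Fin 2) ℝ}
    (hT : IsProbe T) (f g : Matrix (Fin 2) (Fin 2) ℝ → ℝ) (hf : Continuous f) (hg : Continuous g)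
    (hf2 : ∀ (c : ℝ) W, f (c • W) = c ^ 2 * f W) (hg2 : ∀ (c : ℝ) W, g (c • W) = c ^ 2 * g W)
    (hfT : 0 < f T) (hgT : 0 < g T) (h : ∀ W ∈ S, ¬ (0 < f W ∧ 0 < g W)) : Misses S := by
  refine ⟨T, {W | 0 < f W ∧ 0 < g W}, hT, isOpen_setOf_probe hf hg, ?_, ⟨hfT, hgT⟩, h⟩
  rintro W ⟨h1, h2⟩ c hc
  exact ⟨by rw [hf2]; positivity, by rw [hg2]; positivity⟩

/-- Near a unipotent test matrix the antidiagonal product is too small for comparability, so a word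
there is a power of B and its off-diagonal entries are ordered as in B. The test matrix is the one
with the opposite order. -/
lemma misses_of_comparable {A B : Matrix (Fin 2) (Fin 2) ℝ} {κ : ℝ} (hκ0 : 0 < κ) (hκ : κ ≤ 1)
    (hA : ∀ i j, 0 ≤ A i j) (hB : ∀ i j, 0 ≤ B i j) (hAκ : Comparable κ A) :
    Misses (Submonoid.closure {A, B}) := by
  have step : ∀ W ∈ Submonoid.closure {A, B}, 0 < κ * (W 0 0 * W 1 1) - W 0 1 * W 1 0 →
      ∃ x, 0 ≤ x ∧ W 0 1 = x * B 0 1 ∧ W 1 0 = x * B 1 0 := by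
    intro W hW h
    rcases comparable_or_mem_powers hκ hA hB hAκ hW with h' | h'
    · exact absurd h'.1 (by linarith)
    · obtain ⟨x, y, hx, rfl⟩ := exists_eq_smul_add_of_mem_powers hB h'
      exact ⟨x, hx, by simp, by simp⟩
  rcases le_total (B 0 1) (B 1 0) with hle | hle
  · refine misses_of_forms (T := !![1, 1; 0, 1]) (Or.inr (Or.inl rfl))
      (fun W => κ * (W 0 0 * W 1 1) - W 0 1 * W 1 0) (fun W => W 0 1 ^ 2 - W 1 0 ^ 2)
      (by fun_prop) (by fun_prop) (fun c W => by simp; ring) (fun c W => by simp; ring)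
      (by simpa using hκ0) (by simp) ?_
    rintro W hW ⟨h1, h2⟩
    obtain ⟨x, hx, e1, e2⟩ := step W hW h1
    have := pow_le_pow_left₀ (mul_nonneg hx (hB 0 1)) (mul_le_mul_of_nonneg_left hle hx) 2
    simp only [e1, e2] at h2
    linarith
  · refine misses_of_forms (T := !![1, 0; 1, 1]) (Or.inr (Or.inr (Or.inl rfl)))
      (fun W => κ * (W 0 0 * W 1 1) - W 0 1 * W 1 0) (fun W => W 1 0 ^ 2 - W 0 1 ^ 2)
      (by fun_prop) (by fun_prop) (fun c W => by simp; ring) (fun c W => by simp; ring)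
      (by simpa using hκ0) (by simp) ?_
    rintro W hW ⟨h1, h2⟩
    obtain ⟨x, hx, e1, e2⟩ := step W hW h1
    have := pow_le_pow_left₀ (mul_nonneg hx (hB 1 0)) (mul_le_mul_of_nonneg_left hle hx) 2
    simp only [e1, e2] at h2
    linarith

lemma misses_of_det_nonneg {A B : Matrix (Fin 2) (Fin 2) ℝ} (hA : 0 ≤ A.det) (hB : 0 ≤ B.det) :
    Misses (Submonoid.closure {A, B}) := by
  have key : ∀ W ∈ Submonoid.closure {A, B}, 0 ≤ W.det := by
    intro W hW
    induction hW using Submonoid.closure_induction with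
    | mem X hX => rcases hX with rfl | rfl <;> assumption
    | one => simp
    | mul U V _ _ ihU ihV => rw [Matrix.det_mul]; exact mul_nonneg ihU ihV
  refine misses_of_forms (T := !![1, 2; 1, 1]) (Or.inl rfl) (fun W => -W.det) (fun W => -W.det)
    (by fun_prop) (by fun_prop) (fun c W => by simp) (fun c W => by simp) (by norm_num [Matrix.det_fin_two])
    (by norm_num [Matrix.det_fin_two]) ?_
  rintro W hW ⟨h, -⟩
  exact absurd (key W hW) (by linarith)

lemma misses_of_dominatesMonomial {A B : Matrix (Fin 2) (Fin 2) ℝ} {ρ α : ℝ} (hρ : 0 < ρ)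
    (hα : 0 < α) (hA : ∀ i j, 0 ≤ A i j) (hB : ∀ i j, 0 ≤ B i j)
    (hA' : DominatesMonomial ρ α A) (hB' : DominatesMonomial ρ α B) :
    Misses (Submonoid.closure {A, B}) := by
  obtain ⟨u, hu, hgap⟩ := exists_gap_zpow hρ
  -- Any t strictly between 1 and u would do: the forms take the values t − 1 and t(u − t).
  refine misses_of_forms (T := !![(1 + u) / 2, 0; 0, 1])
    (Or.inr (Or.inr (Or.inr ⟨(1 + u) / 2, by linarith, rfl⟩)))
    (fun W => W.det - W 1 1 ^ 2) (fun W => u * W.det - W 0 0 ^ 2)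
    (by fun_prop) (by fun_prop) (fun c W => by simp; ring)
    (fun c W => by simp; ring) ?_ ?_ ?_
  · simp [Matrix.det_fin_two]; linarith
  · simp [Matrix.det_fin_two]; nlinarith
  · rintro W hW ⟨h1, h2⟩
    exact (dominatesMonomial_of_mem_closure hρ hα hA hB hA' hB' hW).not_probe hρ hα hgap
      ⟨by simpa using h1, by simpa using h2⟩

/-- Apart from the comparable case, a nonnegative matrix has a monomial part of the same
determinant. -/
lemma comparable_or_monomial {A : Matrix (Fin 2) (Fin 2) ℝ} (hA : ∀ i j, 0 ≤ A i j) :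
    (∃ κ, 0 < κ ∧ κ ≤ 1 ∧ Comparable κ A) ∨
    (0 < A 0 0 ∧ 0 < A 1 1 ∧ A 0 1 * A 1 0 = 0) ∨ (0 < A 0 1 ∧ 0 < A 1 0 ∧ A 0 0 * A 1 1 = 0) := by
  have split : ∀ i j i' j', 0 < A i j * A i' j' → 0 < A i j ∧ 0 < A i' j' := by
    intro i j i' j' h
    exact ⟨pos_of_mul_pos_left h (hA i' j'), pos_of_mul_pos_right h (hA i j)⟩
  rcases (mul_nonneg (hA 0 0) (hA 1 1)).eq_or_lt' with h | h <;>
    rcases (mul_nonneg (hA 0 1) (hA 1 0)).eq_or_lt' with h' | h'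
  · exact Or.inl ⟨1, one_pos, le_rfl, by simp [Comparable, h, h']⟩
  · exact Or.inr (Or.inr ⟨(split _ _ _ _ h').1, (split _ _ _ _ h').2, h⟩)
  · exact Or.inr (Or.inl ⟨(split _ _ _ _ h).1, (split _ _ _ _ h).2, h'⟩)
  · left
    set m := A 0 0 * A 1 1
    set n := A 0 1 * A 1 0
    refine ⟨min 1 (min (m / n) (n / m)), by positivity, min_le_left _ _, ?_, ?_⟩
    · calc _ ≤ n / m * m := by
            gcongr; exact (min_le_right _ _).trans (min_le_right _ _)
        _ = n := div_mul_cancel₀ _ h.ne'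
    · calc _ ≤ m / n * n := by
            gcongr; exact (min_le_right _ _).trans (min_le_left _ _)
        _ = m := div_mul_cancel₀ _ h'.ne'

/-- Two free parameters fit two generators: α places A at exponent 0 whatever ρ is, and ρ is then
chosen to place B at exponent 1. -/
lemma misses_of_antidiagonal {A B : Matrix (Fin 2) (Fin 2) ℝ} (hA : ∀ i j, 0 ≤ A i j)
    (hB : ∀ i j, 0 ≤ B i j) (h : 0 < A 0 1 ∧ 0 < A 1 0 ∧ A 0 0 * A 1 1 = 0)
    (h' : (0 < B 0 0 ∧ 0 < B 1 1 ∧ B 0 1 * B 1 0 = 0) ∨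
      (0 < B 0 1 ∧ 0 < B 1 0 ∧ B 0 0 * B 1 1 = 0)) :
    Misses (Submonoid.closure {A, B}) := by
  obtain ⟨a1, a2, a3⟩ := h
  have hα : 0 < A 0 1 / A 1 0 := div_pos a1 a2
  have hA' : ∀ ρ : ℝ, DominatesMonomial ρ (A 0 1 / A 1 0) A := fun ρ => by
    refine ⟨0, A 1 0, a2, Or.inr ⟨?_, le_rfl, ?_⟩⟩
    · rw [zpow_zero, mul_one, div_mul_cancel₀ _ a2.ne']
    · rw [zpow_zero, mul_one, div_mul_cancel₀ _ a2.ne', Matrix.det_fin_two, a3, zero_sub]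
  rcases h' with ⟨b1, b2, b3⟩ | ⟨b1, b2, b3⟩
  · refine misses_of_dominatesMonomial (div_pos b1 b2) hα hA hB (hA' _)
      ⟨1, B 1 1, b2, Or.inl ⟨?_, le_rfl, ?_⟩⟩
    · rw [zpow_one, div_mul_cancel₀ _ b2.ne']
    · rw [zpow_one, div_mul_cancel₀ _ b2.ne', Matrix.det_fin_two, b3, sub_zero]
  · have e : A 0 1 / A 1 0 * (B 0 1 / B 1 0 / (A 0 1 / A 1 0)) = B 0 1 / B 1 0 :=
      mul_div_cancel₀ _ hα.ne'
    refine misses_of_dominatesMonomial (div_pos (div_pos b1 b2) hα) hα hA hB (hA' _)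
      ⟨1, B 1 0, b2, Or.inr ⟨?_, le_rfl, ?_⟩⟩
    · rw [zpow_one, e, div_mul_cancel₀ _ b2.ne']
    · rw [zpow_one, e, div_mul_cancel₀ _ b2.ne', Matrix.det_fin_two, b3, zero_sub]

theorem misses_closure_pair {A B : Matrix (Fin 2) (Fin 2) ℝ} (hA : ∀ i j, 0 ≤ A i j)
    (hB : ∀ i j, 0 ≤ B i j) : Misses (Submonoid.closure {A, B}) := by
  rcases comparable_or_monomial hA with ⟨κ, h0, h1, h⟩ | hA'
  · exact misses_of_comparable h0 h1 hA hB h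
  rcases comparable_or_monomial hB with ⟨κ, h0, h1, h⟩ | hB'
  · rw [Set.pair_comm]
    exact misses_of_comparable h0 h1 hB hA h
  rcases hA' with a | a
  · rcases hB' with b | b
    · apply misses_of_det_nonneg
      · rw [Matrix.det_fin_two, a.2.2, sub_zero]; exact mul_nonneg (hA _ _) (hA _ _)
      · rw [Matrix.det_fin_two, b.2.2, sub_zero]; exact mul_nonneg (hB _ _) (hB _ _)
    · rw [Set.pair_comm]
      exact misses_of_antidiagonal hB hA b (Or.inl a)
  · exact misses_of_antidiagonal hA hB a hB'

lemma IsProbe.nonneg {T : Matrix (Fin 2) (Fin 2) ℝ} (hT : IsProbe T) : ∀ i j, 0 ≤ T i j := by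
  rcases hT with rfl | rfl | rfl | ⟨t, ht, rfl⟩ <;> intro i j <;> fin_cases i <;> fin_cases j <;>
    (simp; try linarith)

lemma IsProbe.det_ne_zero {T : Matrix (Fin 2) (Fin 2) ℝ} (hT : IsProbe T) : T.det ≠ 0 := by
  rcases hT with rfl | rfl | rfl | ⟨t, ht, rfl⟩ <;> norm_num [Matrix.det_fin_two]
  linarith

theorem not_dense_closure_pair_nonnegMat (A B : nonnegMat) :
    ¬ Dense (Submonoid.closure ({A, B} : Set nonnegMat) : Set nonnegMat) := by
  intro hd
  obtain ⟨T, U, hT, hU, -, hTU, hmiss⟩ := misses_closure_pair A.2 B.2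
  obtain ⟨W, hW, hWU⟩ := hd.exists_mem_open (hU.preimage continuous_subtype_val)
    ⟨(⟨T, hT.nonneg⟩ : nonnegMat), hTU⟩
  have hle : Submonoid.closure {A, B} ≤
      (Submonoid.closure {(A : Matrix (Fin 2) (Fin 2) ℝ), B.1}).comap nonnegMat.subtype := by
    rw [Submonoid.closure_le]
    rintro X (rfl | rfl)
    · exact Submonoid.subset_closure (Or.inl rfl)
    · exact Submonoid.subset_closure (Or.inr rfl)
  exact hmiss W (hle hW) hWU

/-! ### From maps to matrices through three points -/

open Matrix in
/-- The matrix `M` induces the map `f` in the homogeneous coordinates `v`. -/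
def Represents {X : Type*} (v : X → Fin 2 → ℝ) (M : Matrix (Fin 2) (Fin 2) ℝ)
    (f : Function.End X) : Prop :=
  ∀ x, ∃ μ : ℝ, M *ᵥ v x = μ • v (f x)

lemma Represents.mul {X : Type*} {v : X → Fin 2 → ℝ} {M N : Matrix (Fin 2) (Fin 2) ℝ}
    {f g : Function.End X} (hM : Represents v M f) (hN : Represents v N g) :
    Represents v (M * N) (f * g) := by
  intro x
  obtain ⟨μ, h⟩ := hN x
  obtain ⟨ν, h'⟩ := hM (g x)
  exact ⟨μ * ν, by rw [← Matrix.mulVec_mulVec, h, Matrix.mulVec_smul, h', smul_smul]; rfl⟩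

/-- The determinant of two plane vectors. -/
def wedge (y z : Fin 2 → ℝ) : ℝ := y 0 * z 1 - y 1 * z 0

/-- The matrix, up to scaling, of the projective map sending `v₁, v₂, v₃` to `y₁, y₂, y₃`. -/
def matrixOfThree (v₁ v₂ v₃ y₁ y₂ y₃ : Fin 2 → ℝ) : Matrix (Fin 2) (Fin 2) ℝ :=
  .of fun i => ![wedge v₁ v₃ * wedge y₃ y₂ * y₁ i * v₂ 1 - wedge v₃ v₂ * wedge y₁ y₃ * y₂ i * v₁ 1,
    wedge v₃ v₂ * wedge y₁ y₃ * y₂ i * v₁ 0 - wedge v₁ v₃ * wedge y₃ y₂ * y₁ i * v₂ 0]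

lemma continuous_matrixOfThree {Y : Type*} [TopologicalSpace Y] (v₁ v₂ v₃ : Fin 2 → ℝ)
    {y₁ y₂ y₃ : Y → Fin 2 → ℝ} (h₁ : Continuous y₁) (h₂ : Continuous y₂) (h₃ : Continuous y₃) :
    Continuous fun t => matrixOfThree v₁ v₂ v₃ (y₁ t) (y₂ t) (y₃ t) := by
  have c₁ := fun i => (continuous_apply i).comp h₁
  have c₂ := fun i => (continuous_apply i).comp h₂
  have c₃ := fun i => (continuous_apply i).comp h₃
  simp only [Function.comp_def] at c₁ c₂ c₃
  refine continuous_matrix fun i j => ?_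
  fin_cases j
  · change Continuous fun t => wedge v₁ v₃ * (y₃ t 0 * y₂ t 1 - y₃ t 1 * y₂ t 0) * y₁ t i * v₂ 1 -
      wedge v₃ v₂ * (y₁ t 0 * y₃ t 1 - y₁ t 1 * y₃ t 0) * y₂ t i * v₁ 1
    fun_prop
  · change Continuous fun t => wedge v₃ v₂ * (y₁ t 0 * y₃ t 1 - y₁ t 1 * y₃ t 0) * y₂ t i * v₁ 0 -
      wedge v₁ v₃ * (y₃ t 0 * y₂ t 1 - y₃ t 1 * y₂ t 0) * y₁ t i * v₂ 0
    fun_prop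

-- The construction is linear in each of the three images, so rescaling them only rescales the
-- result. It rests on wedge(y₃,y₂)y₁ + wedge(y₁,y₃)y₂ = wedge(y₁,y₂)y₃.
open Matrix in
lemma matrixOfThree_smul_mulVec (M : Matrix (Fin 2) (Fin 2) ℝ) (v₁ v₂ v₃ : Fin 2 → ℝ)
    (a b c : ℝ) :
    matrixOfThree v₁ v₂ v₃ (a • M *ᵥ v₁) (b • M *ᵥ v₂) (c • M *ᵥ v₃) =
      (a * b * c * M.det * wedge v₁ v₃ * wedge v₃ v₂ * wedge v₁ v₂) • M := by
  ext i j
  fin_cases i <;> fin_cases j <;>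
    simp [matrixOfThree, wedge, Matrix.det_fin_two] <;> ring

lemma Represents.exists_eq_smul {X : Type*} {v : X → Fin 2 → ℝ} {M : Matrix (Fin 2) (Fin 2) ℝ}
    {f : Function.End X} (hM : Represents v M f) (hdet : M.det ≠ 0) {x : X} (hx : v x ≠ 0) :
    ∃ a : ℝ, a ≠ 0 ∧ v (f x) = a • M.mulVec (v x) := by
  obtain ⟨μ, h⟩ := hM x
  have hμ : μ ≠ 0 := by
    rintro rfl
    rw [zero_smul] at h
    exact hx (Matrix.eq_zero_of_mulVec_eq_zero hdet h)
  exact ⟨μ⁻¹, inv_ne_zero hμ, by rw [h, smul_smul, inv_mul_cancel₀ hμ, one_smul]⟩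

lemma Represents.matrixOfThree_eq {X : Type*} {v : X → Fin 2 → ℝ}
    {M : Matrix (Fin 2) (Fin 2) ℝ} {f : Function.End X} (hM : Represents v M f) (hdet : M.det ≠ 0)
    {x₁ x₂ x₃ : X} (h₁₂ : wedge (v x₁) (v x₂) ≠ 0) (h₁₃ : wedge (v x₁) (v x₃) ≠ 0)
    (h₃₂ : wedge (v x₃) (v x₂) ≠ 0) :
    ∃ c : ℝ, c ≠ 0 ∧
      matrixOfThree (v x₁) (v x₂) (v x₃) (v (f x₁)) (v (f x₂)) (v (f x₃)) = c • M := by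
  obtain ⟨a, ha, ea⟩ := hM.exists_eq_smul hdet (x := x₁) (fun h => h₁₂ (by simp [wedge, h]))
  obtain ⟨b, hb, eb⟩ := hM.exists_eq_smul hdet (x := x₂) (fun h => h₁₂ (by simp [wedge, h]))
  obtain ⟨c, hc, ec⟩ := hM.exists_eq_smul hdet (x := x₃) (fun h => h₁₃ (by simp [wedge, h]))
  rw [ea, eb, ec, matrixOfThree_smul_mulVec]
  exact ⟨_, by positivity, rfl⟩

theorem not_dense_of_represents {X : Type*} (F : Submonoid (Function.End X)) [TopologicalSpace F]
    (v : X → Fin 2 → ℝ) (hv : ∀ x, Continuous fun f : F => v (f.1 x)) (x₁ x₂ x₃ : X)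
    (h₁₂ : wedge (v x₁) (v x₂) ≠ 0) (h₁₃ : wedge (v x₁) (v x₃) ≠ 0)
    (h₃₂ : wedge (v x₃) (v x₂) ≠ 0)
    (hrep : ∀ f : F, ∃ M : Matrix (Fin 2) (Fin 2) ℝ,
      (∀ i j, 0 ≤ M i j) ∧ M.det ≠ 0 ∧ Represents v M f.1)
    (hprobe : ∀ T, IsProbe T → ∃ f : F, Represents v T f.1) (f g : F) :
    ¬ Dense (Submonoid.closure ({f, g} : Set F) : Set F) := by
  intro hd
  obtain ⟨A, hA, hAdet, hAf⟩ := hrep f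
  obtain ⟨B, hB, hBdet, hBg⟩ := hrep g
  obtain ⟨T, U, hT, hU, hscale, hTU, hmiss⟩ := misses_closure_pair hA hB
  obtain ⟨t, ht⟩ := hprobe T hT
  have hwords : ∀ h ∈ Submonoid.closure {f, g}, ∃ W ∈ Submonoid.closure {A, B},
      W.det ≠ 0 ∧ Represents v W h.1 := by
    intro h hh
    induction hh using Submonoid.closure_induction with
    | mem X hX =>
      rcases hX with rfl | rfl
      · exact ⟨A, Submonoid.subset_closure (Or.inl rfl), hAdet, hAf⟩
      · exact ⟨B, Submonoid.subset_closure (Or.inr rfl), hBdet, hBg⟩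
    | one => exact ⟨1, one_mem _, by simp, fun x => ⟨1, by simp [Function.End.one_def]⟩⟩
    | mul p q _ _ hp hq =>
      obtain ⟨P, hP, hPdet, hPp⟩ := hp
      obtain ⟨Q, hQ, hQdet, hQq⟩ := hq
      exact ⟨P * Q, mul_mem hP hQ, by rw [Matrix.det_mul]; exact mul_ne_zero hPdet hQdet,
        hPp.mul hQq⟩
  -- Φ is continuous for pointwise convergence and returns a nonzero multiple of any invertible
  -- matrix representing the map, so density would put a word in A, B into the scale-invariant set
  -- U.
  let Φ : F → Matrix (Fin 2) (Fin 2) ℝ := fun h =>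
    matrixOfThree (v x₁) (v x₂) (v x₃) (v (h.1 x₁)) (v (h.1 x₂)) (v (h.1 x₃))
  have hΦ : Continuous Φ := continuous_matrixOfThree _ _ _ (hv x₁) (hv x₂) (hv x₃)
  obtain ⟨a, ha, hta⟩ := ht.matrixOfThree_eq hT.det_ne_zero h₁₂ h₁₃ h₃₂
  obtain ⟨h, hh, hhU⟩ := hd.exists_mem_open (hU.preimage hΦ)
    ⟨t, by rw [Set.mem_preimage]; simp only [Φ]; rw [hta]; exact hscale T hTU a ha⟩
  obtain ⟨W, hW, hWdet, hWh⟩ := hwords h hh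
  obtain ⟨b, hb, hWb⟩ := hWh.matrixOfThree_eq hWdet h₁₂ h₁₃ h₃₂
  rw [Set.mem_preimage] at hhU
  simp only [Φ] at hhU
  rw [hWb] at hhU
  have := hscale _ hhU b⁻¹ (inv_ne_zero hb)
  rw [smul_smul, inv_mul_cancel₀ hb, one_smul] at this
  exact hmiss W hW this

theorem not_dense_closure_pair_nonnegLFT (f g : nonnegLFT) :
    ¬ Dense (Submonoid.closure ({f, g} : Set nonnegLFT) : Set nonnegLFT) := by
  refine not_dense_of_represents nonnegLFT (fun x => ![(x : ℝ), 1]) ?_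
    ⟨1, by simp⟩ ⟨2, by simp⟩ ⟨3, by simp⟩ (by norm_num [wedge]) (by norm_num [wedge])
    (by norm_num [wedge]) ?_ ?_ f g
  · intro x
    have : Continuous fun f : nonnegLFT => ((f.1 x : Set.Ioi (0 : ℝ)) : ℝ) :=
      
      (continuous_apply x).comp (continuous_induced_dom
        (f := fun (f : nonnegLFT) (x : Set.Ioi (0 : ℝ)) => ((f.1 x : Set.Ioi (0 : ℝ)) : ℝ)))
    fun_prop
  · rintro ⟨f, a, b, c, d, ha, hb, hc, hd, hdet, hf⟩
    refine ⟨!![a, b; c, d], ?_, by simpa [Matrix.det_fin_two] using hdet, fun x => ?_⟩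
    · intro i j
      fin_cases i <;> fin_cases j <;> simpa
    · have hx : (0 : ℝ) < x := x.2
      have hcd : c * (x : ℝ) + d ≠ 0 := by
        intro h
        have h1 : 0 ≤ c * (x : ℝ) := by positivity
        have h2 : c = 0 := by
          rcases mul_eq_zero.mp (by linarith : c * (x : ℝ) = 0) with h4 | h4
          · exact h4
          · exact absurd h4 hx.ne'
        have h3 : d = 0 := by linarith
        exact hdet (by rw [h2, h3]; ring)
      refine ⟨c * x + d, ?_⟩
      ext i
      fin_cases i
      · simp [Matrix.mulVec, dotProduct, hf x, mul_div_cancel₀ _ hcd]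
      · simp [Matrix.mulVec, dotProduct]
  · intro T hT
    have hdet := hT.det_ne_zero
    rw [Matrix.det_fin_two] at hdet
    have hpos : ∀ x : Set.Ioi (0 : ℝ), 0 < T 0 0 * (x : ℝ) + T 0 1 ∧ 0 < T 1 0 * (x : ℝ) + T 1 1 := by
      rintro ⟨x, hx⟩
      have hx : 0 < x := hx
      rcases hT with rfl | rfl | rfl | ⟨t, ht, rfl⟩
      · simp; constructor <;> positivity
      · simp; positivity
      · simp; constructor <;> positivity
      · simp; positivity
    refine ⟨⟨fun x => ⟨_, div_pos (hpos x).1 (hpos x).2⟩, T 0 0, T 0 1, T 1 0, T 1 1,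
      hT.nonneg _ _, hT.nonneg _ _, hT.nonneg _ _, hT.nonneg _ _, hdet, fun x => rfl⟩,
      fun x => ⟨T 1 0 * x + T 1 1, ?_⟩⟩
    ext i
    fin_cases i
    · simp [Matrix.mulVec, dotProduct, mul_div_cancel₀ _ (hpos x).2.ne']
    · simp [Matrix.mulVec, dotProduct]

/-! ### Projective charts of intervals -/

/-- Affine coordinates `αx + β` and `γx + δ` on an interval `I` whose ratio maps the interior of
`I` onto `(0, ∞)`. -/
structure IntervalChart (I : Set ℝ) where
  (α β γ δ : ℝ)
  α_nonneg : 0 ≤ α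
  γ_nonpos : γ ≤ 0
  det_pos : 0 < α * δ - β * γ
  nonneg_of_mem : ∀ x ∈ I, 0 ≤ α * x + β ∧ 0 ≤ γ * x + δ
  mem_of_pos : ∀ x, 0 < α * x + β → 0 < γ * x + δ → x ∈ I

/-- The coordinates are x − inf I and sup I − x, with the constant 1 replacing the one belonging to
an infinite end. -/
lemma nonempty_intervalChart {I : Set ℝ} (hI : I.OrdConnected) (hn : I.Nontrivial)
    (hu : I ≠ Set.univ) : Nonempty (IntervalChart I) := by
  have hne := hn.nonempty
  have mem : ∀ x, (∃ y ∈ I, y < x) → (∃ z ∈ I, x < z) → x ∈ I := by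
    rintro x ⟨y, hy, hyx⟩ ⟨z, hz, hxz⟩
    exact hI.out hy hz ⟨hyx.le, hxz.le⟩
  by_cases hb : BddBelow I <;> by_cases ha : BddAbove I
  · obtain ⟨a, haI, b, hbI, hab⟩ := hn.exists_lt
    refine ⟨⟨1, -sInf I, -1, sSup I, zero_le_one, by norm_num, ?_, fun x hx => ⟨?_, ?_⟩,
      fun x h1 h2 => mem x (exists_lt_of_csInf_lt hne (by linarith))
        (exists_lt_of_lt_csSup hne (by linarith))⟩⟩
    · linarith [csInf_le hb haI, le_csSup ha hbI]
    · linarith [csInf_le hb hx]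
    · linarith [le_csSup ha hx]
  · refine ⟨⟨1, -sInf I, 0, 1, zero_le_one, le_rfl, by norm_num, fun x hx => ⟨?_, by norm_num⟩,
      fun x h1 h2 => mem x (exists_lt_of_csInf_lt hne (by linarith)) (not_bddAbove_iff.mp ha x)⟩⟩
    linarith [csInf_le hb hx]
  · refine ⟨⟨0, 1, -1, sSup I, le_rfl, by norm_num, by norm_num, fun x hx => ⟨by norm_num, ?_⟩,
      fun x h1 h2 => mem x (not_bddBelow_iff.mp hb x) (exists_lt_of_lt_csSup hne (by linarith))⟩⟩
    linarith [le_csSup ha hx]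
  · exact absurd (Set.eq_univ_of_forall fun x =>
      mem x (not_bddBelow_iff.mp hb x) (not_bddAbove_iff.mp ha x)) hu

namespace IntervalChart

variable {I : Set ℝ} (φ : IntervalChart I)

/-- The homogeneous coordinates of a point. -/
def coord (x : ℝ) : Fin 2 → ℝ := ![φ.α * x + φ.β, φ.γ * x + φ.δ]

lemma wedge_coord (x y : ℝ) :
    wedge (φ.coord x) (φ.coord y) = (φ.α * φ.δ - φ.β * φ.γ) * (x - y) := by
  simp [wedge, coord]; ring

lemma exists_coord_eq {z w : ℝ} (hz : 0 < z) (hw : 0 < w) :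
    ∃ x ∈ I, ∃ μ : ℝ, 0 < μ ∧ ![z, w] = μ • φ.coord x := by
  have hdet := φ.det_pos
  have hα := φ.α_nonneg
  have hγ := φ.γ_nonpos
  -- Y is the denominator of the inverse chart; α and γ cannot both vanish, since the determinant is
  -- positive.
  have hY : 0 < φ.α * w - φ.γ * z := by
    rcases hα.eq_or_lt with h | h
    · rcases hγ.eq_or_lt with h' | h'
      · rw [← h, h'] at hdet; norm_num at hdet
      · nlinarith
    · nlinarith
  set Y := φ.α * w - φ.γ * z with hYdef
  have e1 : φ.α * ((φ.δ * z - φ.β * w) / Y) + φ.β = z * (φ.α * φ.δ - φ.β * φ.γ) / Y := by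
    field_simp; rw [hYdef]; ring
  have e2 : φ.γ * ((φ.δ * z - φ.β * w) / Y) + φ.δ = w * (φ.α * φ.δ - φ.β * φ.γ) / Y := by
    field_simp; rw [hYdef]; ring
  refine ⟨(φ.δ * z - φ.β * w) / Y, φ.mem_of_pos _ (by rw [e1]; positivity)
    (by rw [e2]; positivity), Y / (φ.α * φ.δ - φ.β * φ.γ), by positivity, ?_⟩
  have := hdet.ne'
  ext i
  fin_cases i
  · simp only [coord, Pi.smul_apply, smul_eq_mul]
    simp only [Fin.zero_eta, Matrix.cons_val_zero]
    rw [e1]; field_simp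
  · simp only [coord, Pi.smul_apply, smul_eq_mul]
    simp only [Fin.mk_one, Matrix.cons_val_one, Matrix.cons_val_fin_one]
    rw [e2]; field_simp

lemma coord_pos_or (x : ℝ) (hx : x ∈ I) :
    (0 < φ.α * x + φ.β ∧ 0 < φ.γ * x + φ.δ) ∨ (φ.α * x + φ.β = 0 ∧ 0 < φ.γ * x + φ.δ) ∨
      (0 < φ.α * x + φ.β ∧ φ.γ * x + φ.δ = 0) := by
  obtain ⟨h1, h2⟩ := φ.nonneg_of_mem x hx
  rcases h1.eq_or_lt' with h1 | h1 <;> rcases h2.eq_or_lt' with h2 | h2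
  · have := φ.det_pos
    have e : φ.α * φ.δ - φ.β * φ.γ = 0 := by linear_combination φ.α * h2 - φ.γ * h1
    linarith
  · exact Or.inr (Or.inl ⟨h1, h2⟩)
  · exact Or.inr (Or.inr ⟨h1, h2⟩)
  · exact Or.inl ⟨h1, h2⟩

/-- This dictates the choice of test matrices: each one fixes an endpoint, (0, w) or (z, 0) in
coordinates, or moves it into the interior. So it acts on I whichever endpoints I contains. -/
lemma probe_mulVec_coord {T : Matrix (Fin 2) (Fin 2) ℝ} (hT : IsProbe T) (x : I) :
    ∃ y : I, ∃ μ : ℝ, 0 < μ ∧ T.mulVec (φ.coord x) = μ • φ.coord y := by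
  have pos : ∀ {z w : ℝ}, 0 < z → 0 < w → ∃ y : I, ∃ μ : ℝ, 0 < μ ∧ ![z, w] = μ • φ.coord y := by
    intro z w hz hw
    obtain ⟨y, hy, h⟩ := φ.exists_coord_eq hz hw
    exact ⟨⟨y, hy⟩, h⟩
  have hx := φ.coord_pos_or x x.2
  have hval : T.mulVec (φ.coord x) = ![T 0 0 * (φ.α * x + φ.β) + T 0 1 * (φ.γ * x + φ.δ),
      T 1 0 * (φ.α * x + φ.β) + T 1 1 * (φ.γ * x + φ.δ)] := by
    ext i
    fin_cases i <;> simp [coord, Matrix.mulVec, dotProduct]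
  have fixed : ∀ {μ : ℝ}, 0 < μ → T.mulVec (φ.coord x) = μ • φ.coord x →
      ∃ y : I, ∃ μ : ℝ, 0 < μ ∧ T.mulVec (φ.coord x) = μ • φ.coord y :=
    fun hμ h => ⟨x, _, hμ, h⟩
  rw [hval] at fixed ⊢
  simp only [coord] at fixed
  generalize φ.α * (x : ℝ) + φ.β = z at *
  generalize φ.γ * (x : ℝ) + φ.δ = w at *
  rcases hT with rfl | rfl | rfl | ⟨t, ht, rfl⟩
  · rcases hx with ⟨hz, hw⟩ | ⟨rfl, hw⟩ | ⟨hz, rfl⟩ <;> exact pos (by simp; positivity)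
      (by simp; positivity)
  · rcases hx with ⟨hz, hw⟩ | ⟨rfl, hw⟩ | ⟨hz, rfl⟩
    · exact pos (by simp; positivity) (by simp; positivity)
    · exact pos (by simp; positivity) (by simp; positivity)
    · exact fixed one_pos (by simp)
  · rcases hx with ⟨hz, hw⟩ | ⟨rfl, hw⟩ | ⟨hz, rfl⟩
    · exact pos (by simp; positivity) (by simp; positivity)
    · exact fixed one_pos (by simp)
    · exact pos (by simp; positivity) (by simp; positivity)
  · have ht0 : 0 < t := by linarith
    rcases hx with ⟨hz, hw⟩ | ⟨rfl, hw⟩ | ⟨hz, rfl⟩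
    · exact pos (by simp; positivity) (by simp; positivity)
    · exact fixed one_pos (by simp)
    · exact fixed ht0 (by simp)

lemma exists_realLFT_represents {T : Matrix (Fin 2) (Fin 2) ℝ} (hT : IsProbe T) :
    ∃ f : realLFT I, Represents (fun x : I => φ.coord x) T f.1 := by
  choose f μ hμ h using φ.probe_mulVec_coord hT
  have hdet := φ.det_pos
  set Δ := φ.α * φ.δ - φ.β * φ.γ with hΔ
  have h0 : ∀ x, T 0 0 * (φ.α * x + φ.β) + T 0 1 * (φ.γ * x + φ.δ) = μ x * (φ.α * f x + φ.β) := by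
    intro x
    simpa [coord, Matrix.mulVec, dotProduct] using congrFun (h x) 0
  have h1 : ∀ x, T 1 0 * (φ.α * x + φ.β) + T 1 1 * (φ.γ * x + φ.δ) = μ x * (φ.γ * f x + φ.δ) := by
    intro x
    simpa [coord, Matrix.mulVec, dotProduct] using congrFun (h x) 1
  -- With C the chart matrix, p, q, r, s are the entries of TC, and the coefficients below are those
  -- of adj(C)TC.
  let p := T 0 0 * φ.α + T 0 1 * φ.γ
  let q := T 0 0 * φ.β + T 0 1 * φ.δ
  let r := T 1 0 * φ.α + T 1 1 * φ.γ
  let s := T 1 0 * φ.β + T 1 1 * φ.δ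
  refine ⟨⟨f, φ.δ * p - φ.β * r, φ.δ * q - φ.β * s, φ.α * r - φ.γ * p, φ.α * s - φ.γ * q,
    ?_, fun x => ?_⟩, fun x => ⟨μ x, h x⟩⟩
  · have : (φ.δ * p - φ.β * r) * (φ.α * s - φ.γ * q) - (φ.δ * q - φ.β * s) * (φ.α * r - φ.γ * p)
        = Δ ^ 2 * T.det := by
      simp only [p, q, r, s, hΔ, Matrix.det_fin_two]; ring
    rw [this]
    exact mul_ne_zero (by positivity) hT.det_ne_zero
  · have e1 : (φ.α * r - φ.γ * p) * (x : ℝ) + (φ.α * s - φ.γ * q) = μ x * Δ := by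
      simp only [p, q, r, s, hΔ]; linear_combination φ.α * h1 x - φ.γ * h0 x
    have e2 : (φ.δ * p - φ.β * r) * (x : ℝ) + (φ.δ * q - φ.β * s) = μ x * Δ * f x := by
      simp only [p, q, r, s, hΔ]; linear_combination φ.δ * h0 x - φ.β * h1 x
    have hne : μ x * Δ ≠ 0 := (mul_pos (hμ x) hdet).ne'
    exact ⟨by rw [e1]; exact hne, by rw [e1, e2, mul_div_cancel_left₀ _ hne]⟩

end IntervalChart

/-- Rescaling by `-1`, the denominator of a linear fractional map may be taken positive. -/
lemma exists_pos_denominator {I : Set ℝ} (hI : I.OrdConnected) (f : realLFT I) :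
    ∃ a b c d : ℝ, a * d - b * c ≠ 0 ∧
      ∀ x : I, 0 < c * (x : ℝ) + d ∧ (c * (x : ℝ) + d) * (f.1 x : I) = a * x + b := by
  obtain ⟨f, a, b, c, d, hdet, hf⟩ := f
  have hmul : ∀ x : I, (c * (x : ℝ) + d) * (f x : I) = a * x + b := fun x => by
    rw [(hf x).2, mul_div_cancel₀ _ (hf x).1]
  by_cases h : ∀ x : I, 0 < c * (x : ℝ) + d
  · exact ⟨a, b, c, d, hdet, fun x => ⟨h x, hmul x⟩⟩
  push Not at h
  obtain ⟨x, hx⟩ := h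
  refine ⟨-a, -b, -c, -d, by rwa [neg_mul_neg, neg_mul_neg], fun y => ⟨?_, ?_⟩⟩
  · by_contra hy
    have hpre := hI.isPreconnected.intermediate_value x.2 y.2
      (f := fun t => c * t + d) (by fun_prop)
    obtain ⟨t, ht, ht0⟩ := hpre (Set.mem_Icc.mpr ⟨hx, by linarith⟩)
    exact (hf ⟨t, ht⟩).1 ht0
  · linear_combination -hmul y

lemma nonneg_of_forall_pos {p q : ℝ} (h : ∀ z w : ℝ, 0 < z → 0 < w → 0 ≤ p * z + q * w) :
    0 ≤ p ∧ 0 ≤ q := by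
  constructor
  · by_contra hp
    push Not at hp
    have := h ((|q| + 1) / -p) 1 (div_pos (by positivity) (by linarith)) one_pos
    have e : p * ((|q| + 1) / -p) = -(|q| + 1) := by
      rw [div_neg, mul_neg, mul_div_cancel₀ _ hp.ne]
    rw [e] at this
    linarith [le_abs_self q]
  · by_contra hq
    push Not at hq
    have := h 1 ((|p| + 1) / -q) one_pos (div_pos (by positivity) (by linarith))
    have e : q * ((|p| + 1) / -q) = -(|p| + 1) := by
      rw [div_neg, mul_neg, mul_div_cancel₀ _ hq.ne]
    rw [e] at this
    linarith [le_abs_self p]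

/-- Every positive vector is a positive multiple of the coordinates of a point of I. The point's
image stays in I and its denominator is positive, so the conjugated matrix maps the open quadrant
into the closed one; hence its entries are nonnegative. -/
lemma IntervalChart.exists_nonneg_represents {I : Set ℝ} (φ : IntervalChart I)
    (hI : I.OrdConnected) (f : realLFT I) : ∃ M : Matrix (Fin 2) (Fin 2) ℝ,
      (∀ i j, 0 ≤ M i j) ∧ M.det ≠ 0 ∧ Represents (fun x : I => φ.coord x) M f.1 := by
  obtain ⟨a, b, c, d, hdet, hf⟩ := exists_pos_denominator hI f
  have hΔ := φ.det_pos
  set Δ := φ.α * φ.δ - φ.β * φ.γ with hΔdef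
  let M : Matrix (Fin 2) (Fin 2) ℝ :=
    !![φ.α, φ.β; φ.γ, φ.δ] * !![a, b; c, d] * !![φ.δ, -φ.β; -φ.γ, φ.α]
  have hM : ∀ x : I, M.mulVec (φ.coord x) = (Δ * (c * x + d)) • φ.coord (f.1 x : I) := by
    intro x
    ext i
    fin_cases i <;>
      simp [M, coord, Matrix.mulVec, dotProduct, Fin.sum_univ_two, hΔdef]
    · linear_combination (-(φ.α * φ.δ - φ.β * φ.γ) * φ.α) * (hf x).2
    · linear_combination (-(φ.α * φ.δ - φ.β * φ.γ) * φ.γ) * (hf x).2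
  have hrow : ∀ i, ∀ z w : ℝ, 0 < z → 0 < w → 0 ≤ M i 0 * z + M i 1 * w := by
    intro i z w hz hw
    obtain ⟨x, hx, μ, hμ, e⟩ := φ.exists_coord_eq hz hw
    have h1 : M.mulVec ![z, w] i = μ * (Δ * (c * x + d)) * φ.coord (f.1 ⟨x, hx⟩ : I) i := by
      have := congrFun (hM ⟨x, hx⟩) i
      rw [e, Matrix.mulVec_smul, Pi.smul_apply, this]
      simp [mul_assoc]
    have h2 : 0 ≤ φ.coord (f.1 ⟨x, hx⟩ : I) i := by
      have := φ.nonneg_of_mem _ (f.1 ⟨x, hx⟩ : I).2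
      fin_cases i
      · exact this.1
      · exact this.2
    have h3 : M.mulVec ![z, w] i = M i 0 * z + M i 1 * w := by
      simp [Matrix.mulVec, dotProduct]
    rw [← h3, h1]
    have := (hf ⟨x, hx⟩).1
    positivity
  refine ⟨M, fun i j => ?_, ?_, fun x => ⟨_, hM x⟩⟩
  · have := nonneg_of_forall_pos (hrow i)
    fin_cases j
    · exact this.1
    · exact this.2
  · have e : M.det = Δ ^ 2 * (a * d - b * c) := by
      simp only [M, Matrix.det_mul, Matrix.det_fin_two_of, hΔdef]; ring
    rw [e]
    exact mul_ne_zero (by positivity) hdet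

theorem not_dense_closure_pair_realLFT {I : Set ℝ} (hI : I.OrdConnected) (hn : I.Nontrivial)
    (hu : I ≠ Set.univ) (f g : realLFT I) :
    ¬ Dense (Submonoid.closure ({f, g} : Set (realLFT I)) : Set (realLFT I)) := by
  obtain ⟨φ⟩ := nonempty_intervalChart hI hn hu
  obtain ⟨a, ha, b, hb, hab⟩ := hn.exists_lt
  have hwedge : ∀ {x y : ℝ}, x ≠ y → wedge (φ.coord x) (φ.coord y) ≠ 0 := fun hxy => by
    rw [φ.wedge_coord]
    exact mul_ne_zero φ.det_pos.ne' (sub_ne_zero.mpr hxy)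
  have hm : (a + b) / 2 ∈ I := hI.out ha hb ⟨by linarith, by linarith⟩
  refine not_dense_of_represents (realLFT I) (fun x => φ.coord x) ?_ ⟨a, ha⟩ ⟨b, hb⟩
    ⟨(a + b) / 2, hm⟩ (hwedge hab.ne) (hwedge ?_) (hwedge ?_)
    (φ.exists_nonneg_represents hI) (fun T hT => φ.exists_realLFT_represents hT) f g
  · intro x
    have : Continuous fun f : realLFT I => ((f.1 x : I) : ℝ) :=
      (continuous_apply x).comp (continuous_induced_dom
        (f := fun (f : realLFT I) (x : I) => ((f.1 x : I) : ℝ)))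
    unfold IntervalChart.coord
    fun_prop
  · simp only; intro h; linarith
  · simp only; intro h; linarith

theorem mainTheorem2 :
    (∀ f g : nonnegLFT,
      ¬ Dense (Submonoid.closure ({f, g} : Set nonnegLFT) : Set nonnegLFT)) ∧
    (∀ I : Set ℝ, I.OrdConnected → I.Nontrivial → I ≠ Set.univ →
      ∀ f g : realLFT I,
        ¬ Dense (Submonoid.closure ({f, g} : Set (realLFT I)) : Set (realLFT I))) ∧
    (∀ A B : nonnegMat,
      ¬ Dense (Submonoid.closure ({A, B} : Set nonnegMat) : Set nonnegMat)) :=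
  ⟨not_dense_closure_pair_nonnegLFT, fun _ hI hn hu => not_dense_closure_pair_realLFT hI hn hu,
    not_dense_closure_pair_nonnegMat⟩
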